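/- Let $\alpha\in(0,2)$ and let $m\in L^\alpha(\mathbb R)$ (i.e. $m$ is measurable and $\int_{\mathbb R}|m(x)|^\alpha\,dx<\infty$) be nonnegative. Let $\Lambda$ be a symmetric $\alpha$-stable (S$\alpha$S) random measure on $\mathbb R$ with Lebesgue control measure, that is, an independently scattered, almost surely $\sigma$-additive random set function on the Borel sets $A$ of finite Lebesgue measure $|A|$ with $\mathbb E\,e^{is\Lambda(A)}=\exp(-|A|\,|s|^\alpha)$, $s\in\mathbb R$. Let $X=\{X(t),\,t\in\mathbb R\}$ be the S$\alpha$S moving average $$X(t)=\int_{\mathbb R} m(t-x)\,\Lambda(dx),\qquad t\in\mathbb R,$$ where the stochastic integral of a function in $L^\alpha(\mathbb R)$ is the limit in probability of the integrals of simple functions converging to it in $L^\alpha(\mathbb R)$. Let $a>0$. A stationary process $X=\{X(t),\,t\in\mathbb R\}$ (all finite-dimensional distributions are invariant under translations) is called long range dependent if there is a finite measure $\mu$ on $\mathbb R$ such that $$\int_{\mathbb R}\int_{\mathbb R}\int_{\mathbb R}\bigl|\mathrm{Cov}\bigl(\mathbf 1\{X(0)>u\},\mathbf 1\{X(t)>v\}\bigr)\bigr|\,\mu(du)\,\mu(dv)\,dt=\infty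 .$$ (i) If $m$ is monotonically decreasing on $(a,\infty)$ and $\int_a^\infty t\,m^\alpha(t)\,dt=\infty$, then $X$ is (stationary and) long range dependent. (ii) If $m$ is monotonically increasing on $(-\infty,-a)$ and $\int_{-\infty}^{-a}t\,m^\alpha(t)\,dt=-\infty$, then $X$ is (stationary and) long range dependent. (iii) If $m$ is symmetric, i.e. $m(-x)=m(x)$ for all $x\in\mathbb R$, then $\int_a^\infty t\,m^\alpha(t)\,dt=\infty$ if and only if $\int_{-\infty}^{-a}t\,m^\alpha(t)\,dt=-\infty$. -/

import Mathlib

open MeasureTheory ProbabilityTheory Filter Topology Set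
open scoped ENNReal

/-- `Λ` is a symmetric `α`-stable random measure on `ℝ` with Lebesgue control measure, defined on
the probability space `(Ω, P)`: to every Borel set `A` of finite Lebesgue measure it assigns a
random variable `Λ A` with characteristic function `s ↦ exp (-|A| |s| ^ α)`, it is independently
scattered, and it is `σ`-additive almost surely. The values of `Λ` on other sets are irrelevant.

The series in `sigma_additive` converges in the given order of the sets
(for `α ≥ 1` it need not converge absolutely). -/
structure IsSaSRandomMeasure {Ω : Type*} [MeasurableSpace Ω] (α : ℝ) (P : Measure Ω)
    (Λ : Set ℝ → Ω → ℝ) : Prop where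
  measurable : ∀ A : Set ℝ, MeasurableSet A → volume A < ∞ → Measurable (Λ A)
  charFun_eq : ∀ A : Set ℝ, MeasurableSet A → volume A < ∞ → ∀ s : ℝ,
    charFun (P.map (Λ A)) s = ((Real.exp (-((volume A).toReal * |s| ^ α)) : ℝ) : ℂ)
  indep : ∀ (n : ℕ) (A : Fin n → Set ℝ), (∀ i, MeasurableSet (A i)) →
    (∀ i, volume (A i) < ∞) → (∀ i j, i ≠ j → Disjoint (A i) (A j)) →
    iIndepFun (fun i ↦ Λ (A i)) P
  sigma_additive : ∀ A : ℕ → Set ℝ, (∀ i, MeasurableSet (A i)) →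
    (∀ i j, i ≠ j → Disjoint (A i) (A j)) → volume (⋃ i, A i) < ∞ →
    ∀ᵐ ω ∂P, Tendsto (fun n : ℕ ↦ ∑ i ∈ Finset.range n, Λ (A i) ω) atTop
      (𝓝 (Λ (⋃ i, A i) ω))

/-- The integral `∑ c, c * Λ {f = c}` of a simple function `f` with respect to `Λ`. The term with
`c = 0` vanishes, so only sets of finite measure matter if `f` vanishes outside such a set. -/
noncomputable def simpleStochInt {Ω : Type*} (Λ : Set ℝ → Ω → ℝ) (f : SimpleFunc ℝ ℝ) (ω : Ω) : ℝ :=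
  ∑ c ∈ f.range, c * Λ (f ⁻¹' {c}) ω

/-- `Y` is (a version of) the stochastic integral `∫ f dΛ` of `f ∈ L^α(ℝ)`: it is the limit in
probability of the integrals of simple functions, supported on sets of finite Lebesgue measure,
that converge to `f` in `L^α(ℝ)`. -/
def IsStochInt {Ω : Type*} [MeasurableSpace Ω] (α : ℝ) (P : Measure Ω)
    (Λ : Set ℝ → Ω → ℝ) (f : ℝ → ℝ) (Y : Ω → ℝ) : Prop :=
  ∃ g : ℕ → SimpleFunc ℝ ℝ, (∀ n, (g n).FinMeasSupp volume) ∧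
    Tendsto (fun n ↦ ∫⁻ x, ENNReal.ofReal (|g n x - f x| ^ α)) atTop (𝓝 0) ∧
    TendstoInMeasure P (fun n ↦ simpleStochInt Λ (g n)) atTop Y

/-- `X` is a symmetric `α`-stable moving average with kernel function `m`, that is,
`X t = ∫ m (t - x) Λ(dx)` for all `t`, where `Λ` is a symmetric `α`-stable random measure on `ℝ`
with Lebesgue control measure. -/
def IsSaSMovingAverage {Ω : Type*} [MeasurableSpace Ω] (α : ℝ) (P : Measure Ω) (m : ℝ → ℝ)
    (X : ℝ → Ω → ℝ) : Prop :=
  ∃ Λ : Set ℝ → Ω → ℝ, IsSaSRandomMeasure α P Λ ∧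
    ∀ t : ℝ, IsStochInt α P Λ (fun x ↦ m (t - x)) (X t)

/-- All finite-dimensional distributions of `X` are invariant under translations. -/
def IsStationaryProcess {Ω : Type*} [MeasurableSpace Ω] (P : Measure Ω) (X : ℝ → Ω → ℝ) : Prop :=
  ∀ (n : ℕ) (t : Fin n → ℝ) (h : ℝ),
    IdentDistrib (fun ω i ↦ X (t i + h) ω) (fun ω i ↦ X (t i) ω) P P

/-- The covariance `Cov (1 {X 0 > u}, 1 {X t > v})` of excursion indicators. -/
noncomputable def excursionCov {Ω : Type*} [MeasurableSpace Ω] (P : Measure Ω) (X : ℝ → Ω → ℝ)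
    (t u v : ℝ) : ℝ :=
  covariance ({ω | X 0 ω > u}.indicator fun _ ↦ (1 : ℝ))
    ({ω | X t ω > v}.indicator fun _ ↦ (1 : ℝ)) P

/-- The stationary process `X` (indexed by `ℝ`) is long range dependent: for some finite measure
`μ`, the integral of `|Cov (1 {X 0 > u}, 1 {X t > v})|` with respect to `μ(du) μ(dv) dt` is
infinite. -/
def IsLongRangeDependent {Ω : Type*} [MeasurableSpace Ω] (P : Measure Ω) (X : ℝ → Ω → ℝ) : Prop :=
  IsStationaryProcess P X ∧
    ∃ μ : Measure ℝ, IsFiniteMeasure μ ∧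
      ∫⁻ t, ∫⁻ v, ∫⁻ u, ENNReal.ofReal |excursionCov P X t u v| ∂μ ∂μ = ∞

/-- `∫_a^∞ t m(t)^α dt = ∞`, for a nonnegative function `m` and `a > 0`. -/
def RightMomentInfinite (α : ℝ) (m : ℝ → ℝ) (a : ℝ) : Prop :=
  ∫⁻ t in Ioi a, ENNReal.ofReal (t * m t ^ α) = ∞

/-- `∫_{-∞}^{-a} t m(t)^α dt = -∞`, for a nonnegative function `m` and `a > 0`. The integrand is
nonpositive, and its negative is integrated. -/
def LeftMomentInfinite (α : ℝ) (m : ℝ → ℝ) (a : ℝ) : Prop :=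
  ∫⁻ t in Iio (-a), ENNReal.ofReal (-(t * m t ^ α)) = ∞

/-!
For frequencies `s` and `r`, the law of a linear combination of `X 0` and `X t` gives
`E cos (s X 0 ± r X t) = exp (-∫ |s m (-x) ± r m (t - x)| ^ α dx)`. Concavity of `u ↦ u ^ (α / 2)`,
which is strict because `α < 2`, makes the mean of these two exponents smaller than
`∫ |s m (-x)| ^ α + |r m (t - x)| ^ α dx` by at least a constant multiple of the overlap
`∫ min (|s m (-x)|, |r m (t - x)|) ^ α dx`, so that the covariance of `cos (s X 0)` and
`cos (r X t)` is bounded below by the overlap. Averaging over independent standard Gaussian `s` and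
`r` turns the cosines into `F (X 0)` and `F (X t)` with `F x = exp (-x ^ 2 / 2)`, whose covariance
is, by Hoeffding's formula, the integral of the excursion covariances against `F' (u) F' (v) du dv`.
Hence `X` is long range dependent with `μ (du) = |F' (u)| du` as soon as the overlaps of the kernel
with its translates have infinite integral. If `|m|` decreases on `(a, ∞)`, the overlap with the
translate by `t` dominates the tail `∫_{a + t}^∞ |m| ^ α`, and the integral of these tails over
`t > 0` is `∫_a^∞ (z - a) |m z| ^ α dz`.
-/

section ConcavityOfPowers

theorem add_le_add_of_concaveOn {𝕜 E β : Type*} [Semiring 𝕜] [PartialOrder 𝕜] [AddCommMonoid E]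
    [AddCommMonoid β] [PartialOrder β] [IsOrderedAddMonoid β] [SMul 𝕜 E] [Module 𝕜 β]
    {s : Set E} {f : E → β} (hf : ConcaveOn 𝕜 s f) {x y : E} (hx : x ∈ s) (hy : y ∈ s)
    {a b : 𝕜} (ha : 0 ≤ a) (hb : 0 ≤ b) (hab : a + b = 1) :
    f x + f y ≤ f (a • x + b • y) + f (b • x + a • y) := by
  calc f x + f y = (a • f x + b • f y) + (b • f x + a • f y) := by
        rw [add_add_add_comm, add_comm (b • f y), ← add_smul, ← add_smul, hab, one_smul, one_smul]
    _ ≤ f (a • x + b • y) + f (b • x + a • y) :=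
        add_le_add (hf.2 hx hy ha hb hab) (hf.2 hx hy hb ha (by rwa [add_comm]))

/- The points `u` and `2 * v` lie symmetrically between `v` and `u + v`. -/
theorem add_rpow_add_mul_rpow_le {p u v : ℝ} (hp0 : 0 ≤ p) (hp1 : p ≤ 1) (hv : 0 ≤ v)
    (hvu : v ≤ u) : (u + v) ^ p + (2 - 2 ^ p) * v ^ p ≤ u ^ p + v ^ p := by
  have two_mul_rpow : (2 * v) ^ p = 2 ^ p * v ^ p := Real.mul_rpow zero_le_two hv
  suffices v ^ p + (u + v) ^ p ≤ u ^ p + (2 * v) ^ p by linarith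
  rcases (hv.trans hvu).eq_or_lt with rfl | hu
  · simp [le_antisymm hvu hv]
  · have := add_le_add_of_concaveOn (Real.concaveOn_rpow hp0 hp1) (mem_Ici.2 hv)
      (mem_Ici.2 (add_nonneg hu.le hv)) (div_nonneg hv hu.le)
      (div_nonneg (sub_nonneg.2 hvu) hu.le) (by field_simp; ring)
    have eq_u : v / u * v + (u - v) / u * (u + v) = u := by field_simp; ring
    have eq_two_mul : (u - v) / u * v + v / u * (u + v) = 2 * v := by field_simp; ring
    simpa only [smul_eq_mul, eq_u, eq_two_mul] using this

theorem abs_rpow_eq_sq_rpow_half (x p : ℝ) : |x| ^ p = (x ^ 2) ^ (p / 2) := by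
  rw [← sq_abs, ← Real.rpow_natCast_mul (abs_nonneg x)]
  congr 1
  push_cast
  ring

theorem abs_add_rpow_add_abs_sub_rpow_le {α : ℝ} (hα0 : 0 ≤ α) (hα2 : α ≤ 2) (x y : ℝ) :
    (|x + y| ^ α + |x - y| ^ α) / 2 + (2 - 2 ^ (α / 2)) * min |x| |y| ^ α
      ≤ |x| ^ α + |y| ^ α := by
  wlog hyx : |y| ≤ |x| generalizing x y
  · simpa only [add_comm y x, abs_sub_comm y x, min_comm |y|, add_comm (|y| ^ α)]
      using this y x (le_of_not_ge hyx)
  have concave_midpoint : (|x + y| ^ α + |x - y| ^ α) / 2 ≤ (x ^ 2 + y ^ 2) ^ (α / 2) := by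
    have := (Real.concaveOn_rpow (p := α / 2) (by linarith) (by linarith)).2
      (mem_Ici.2 (sq_nonneg (x + y))) (mem_Ici.2 (sq_nonneg (x - y)))
      (one_half_pos (α := ℝ)).le (one_half_pos (α := ℝ)).le (add_halves 1)
    have midpoint : 1 / 2 * (x + y) ^ 2 + 1 / 2 * (x - y) ^ 2 = x ^ 2 + y ^ 2 := by ring
    simp only [smul_eq_mul, midpoint] at this
    rw [abs_rpow_eq_sq_rpow_half, abs_rpow_eq_sq_rpow_half]
    linarith
  have := add_rpow_add_mul_rpow_le (p := α / 2) (by linarith) (by linarith) (sq_nonneg y)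
    (sq_le_sq.2 hyx)
  rw [min_eq_right hyx, abs_rpow_eq_sq_rpow_half x, abs_rpow_eq_sq_rpow_half y]
  linarith

theorem two_sub_two_rpow_pos {p : ℝ} (hp : p < 1) : (0 : ℝ) < 2 - 2 ^ p := by
  simpa using Real.rpow_lt_rpow_of_exponent_lt one_lt_two hp

end ConcavityOfPowers

section LpQuasinorm

variable {β E : Type*} [MeasurableSpace β] {μ : Measure β} [NormedAddCommGroup E] {p : ℝ}

theorem ofReal_norm_rpow (hp : 0 ≤ p) (x : E) : ENNReal.ofReal (‖x‖ ^ p) = ‖x‖ₑ ^ p := by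
  rw [← ofReal_norm, ENNReal.ofReal_rpow_of_nonneg (norm_nonneg x) hp]

theorem integral_norm_rpow_eq_toReal_lintegral (hp : 0 ≤ p) {f : β → E}
    (hf : AEStronglyMeasurable f μ) : ∫ x, ‖f x‖ ^ p ∂μ = (∫⁻ x, ‖f x‖ₑ ^ p ∂μ).toReal := by
  rw [integral_eq_lintegral_of_nonneg_ae (ae_of_all _ fun x ↦ by positivity)
    (hf.norm.aemeasurable.pow_const p).aestronglyMeasurable]
  simp only [ofReal_norm_rpow hp]

theorem lintegral_enorm_add_rpow_le (hp : 0 < p) {f g : β → E} (hf : AEStronglyMeasurable f μ)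
    (hg : AEStronglyMeasurable g μ) :
    (∫⁻ x, ‖f x + g x‖ₑ ^ p ∂μ) ^ min 1 (1 / p)
      ≤ (∫⁻ x, ‖f x‖ₑ ^ p ∂μ) ^ min 1 (1 / p) + (∫⁻ x, ‖g x‖ₑ ^ p ∂μ) ^ min 1 (1 / p) := by
  rcases le_total p 1 with hp1 | hp1
  · rw [min_eq_left (one_le_one_div hp hp1)]
    simp only [ENNReal.rpow_one]
    rw [← lintegral_add_left' (hf.enorm.pow_const p)]
    exact lintegral_mono fun x ↦ (ENNReal.rpow_le_rpow (enorm_add_le _ _) hp.le).trans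
      (ENNReal.rpow_add_le_add_rpow _ _ hp.le hp1)
  · rw [min_eq_right ((div_le_one hp).2 hp1)]
    exact eLpNorm'_add_le hf hg hp1

theorem tendsto_lintegral_enorm_add_rpow_zero {ι : Type*} {l : Filter ι} (hp : 0 < p)
    {f g : ι → β → E} (hf : ∀ i, AEStronglyMeasurable (f i) μ)
    (hg : ∀ i, AEStronglyMeasurable (g i) μ)
    (hf0 : Tendsto (fun i ↦ ∫⁻ x, ‖f i x‖ₑ ^ p ∂μ) l (𝓝 0))
    (hg0 : Tendsto (fun i ↦ ∫⁻ x, ‖g i x‖ₑ ^ p ∂μ) l (𝓝 0)) :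
    Tendsto (fun i ↦ ∫⁻ x, ‖f i x + g i x‖ₑ ^ p ∂μ) l (𝓝 0) := by
  have add_le (i : ι) := lintegral_enorm_add_rpow_le hp (hf i) (hg i)
  set q := min 1 (1 / p)
  have hq : 0 < q := lt_min one_pos (one_div_pos.2 hp)
  have rpow_tendsto : Tendsto (fun i ↦ (∫⁻ x, ‖f i x + g i x‖ₑ ^ p ∂μ) ^ q) l (𝓝 0) :=
    tendsto_of_tendsto_of_tendsto_of_le_of_le tendsto_const_nhds
      (by simpa [hq] using (hf0.ennrpow_const q).add (hg0.ennrpow_const q)) (fun _ ↦ zero_le) add_le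
  simpa [ENNReal.rpow_rpow_inv hq.ne', hq] using rpow_tendsto.ennrpow_const q⁻¹

theorem tendsto_lintegral_enorm_rpow {ι : Type*} {l : Filter ι} (hp : 0 < p) {g : ι → β → E}
    {f : β → E} (hg : ∀ i, AEStronglyMeasurable (g i) μ) (hf : AEStronglyMeasurable f μ)
    (hfin : ∫⁻ x, ‖f x‖ₑ ^ p ∂μ ≠ ∞)
    (h : Tendsto (fun i ↦ ∫⁻ x, ‖g i x - f x‖ₑ ^ p ∂μ) l (𝓝 0)) :
    Tendsto (fun i ↦ ∫⁻ x, ‖g i x‖ₑ ^ p ∂μ) l (𝓝 (∫⁻ x, ‖f x‖ₑ ^ p ∂μ)) := by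
  have add_le {f g : β → E} (hf : AEStronglyMeasurable f μ) (hg : AEStronglyMeasurable g μ) :=
    lintegral_enorm_add_rpow_le hp hf hg
  set q := min 1 (1 / p)
  have hq : 0 < q := lt_min one_pos (one_div_pos.2 hp)
  have dist_tendsto : Tendsto (fun i ↦ (∫⁻ x, ‖g i x - f x‖ₑ ^ p ∂μ) ^ q) l (𝓝 0) := by
    simpa only [ENNReal.zero_rpow_of_pos hq] using h.ennrpow_const q
  have le_add_dist (i) : (∫⁻ x, ‖g i x‖ₑ ^ p ∂μ) ^ q
      ≤ (∫⁻ x, ‖f x‖ₑ ^ p ∂μ) ^ q + (∫⁻ x, ‖g i x - f x‖ₑ ^ p ∂μ) ^ q := by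
    simpa using add_le hf ((hg i).sub hf)
  have sub_dist_le (i) : (∫⁻ x, ‖f x‖ₑ ^ p ∂μ) ^ q - (∫⁻ x, ‖g i x - f x‖ₑ ^ p ∂μ) ^ q
      ≤ (∫⁻ x, ‖g i x‖ₑ ^ p ∂μ) ^ q := by
    simpa [enorm_sub_rev] using add_le (hg i) (hf.sub (hg i))
  have rpow_tendsto : Tendsto (fun i ↦ (∫⁻ x, ‖g i x‖ₑ ^ p ∂μ) ^ q) l
      (𝓝 ((∫⁻ x, ‖f x‖ₑ ^ p ∂μ) ^ q)) := by
    refine tendsto_of_tendsto_of_tendsto_of_le_of_le ?_ ?_ sub_dist_le le_add_dist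
    · simpa using ENNReal.Tendsto.sub tendsto_const_nhds dist_tendsto
        (Or.inl (ENNReal.rpow_ne_top_of_nonneg hq.le hfin))
    · simpa using tendsto_const_nhds.add dist_tendsto
  simpa [ENNReal.rpow_rpow_inv hq.ne'] using rpow_tendsto.ennrpow_const q⁻¹

theorem tendsto_integral_norm_rpow {ι : Type*} {l : Filter ι} (hp : 0 < p) {g : ι → β → E}
    {f : β → E} (hg : ∀ i, AEStronglyMeasurable (g i) μ) (hf : MemLp f (ENNReal.ofReal p) μ)
    (h : Tendsto (fun i ↦ ∫⁻ x, ‖g i x - f x‖ₑ ^ p ∂μ) l (𝓝 0)) :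
    Tendsto (fun i ↦ ∫ x, ‖g i x‖ ^ p ∂μ) l (𝓝 (∫ x, ‖f x‖ ^ p ∂μ)) := by
  have hfin : ∫⁻ x, ‖f x‖ₑ ^ p ∂μ ≠ ∞ := by
    simpa only [ENNReal.toReal_ofReal hp.le] using (lintegral_rpow_enorm_lt_top_of_eLpNorm_lt_top
      (ENNReal.ofReal_pos.2 hp).ne' ENNReal.ofReal_ne_top hf.2).ne
  simp only [integral_norm_rpow_eq_toReal_lintegral hp.le (hg _),
    integral_norm_rpow_eq_toReal_lintegral hp.le hf.1]
  exact (ENNReal.tendsto_toReal hfin).comp (tendsto_lintegral_enorm_rpow hp hg hf.1 hfin h)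

end LpQuasinorm

section ConvergenceInMeasure

variable {ι β E : Type*} [MeasurableSpace β] {μ : Measure β} [SeminormedAddCommGroup E]
  {l : Filter ι} {f g : ι → β → E} {F G : β → E}

theorem tendstoInMeasure_add (hf : TendstoInMeasure μ f l F) (hg : TendstoInMeasure μ g l G) :
    TendstoInMeasure μ (fun i ↦ f i + g i) l (F + G) := by
  rw [tendstoInMeasure_iff_norm] at hf hg ⊢
  intro ε hε
  refine tendsto_of_tendsto_of_tendsto_of_le_of_le tendsto_const_nhds
    (by simpa using (hf (ε / 2) (half_pos hε)).add (hg (ε / 2) (half_pos hε)))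
    (fun _ ↦ zero_le) fun i ↦ (measure_mono fun x hx ↦ ?_).trans (measure_union_le _ _)
  by_contra! hsmall
  simp only [mem_union, mem_ofPred_eq, not_or, not_le, Pi.add_apply] at hx hsmall
  have := norm_add_le (f i x - F x) (g i x - G x)
  rw [← add_sub_add_comm] at this
  linarith

theorem tendstoInMeasure_const_smul {𝕜 : Type*} [NormedField 𝕜] [NormedSpace 𝕜 E]
    (hf : TendstoInMeasure μ f l F) (c : 𝕜) :
    TendstoInMeasure μ (fun i ↦ c • f i) l (c • F) := by
  rcases eq_or_ne c 0 with rfl | hc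
  · simpa [tendstoInMeasure_iff_norm] using fun ε hε ↦ by simp [not_le.2 hε, tendsto_const_nhds]
  rw [tendstoInMeasure_iff_norm] at hf ⊢
  intro ε hε
  convert hf (ε / ‖c‖) (div_pos hε (norm_pos_iff.2 hc)) using 5 with i x
  rw [div_le_iff₀' (norm_pos_iff.2 hc), Pi.smul_apply, Pi.smul_apply, ← smul_sub, norm_smul]

end ConvergenceInMeasure

theorem integral_comp_simpleFunc {β E F : Type*} [MeasurableSpace β] {μ : Measure β}
    [NormedAddCommGroup E] [NormedAddCommGroup F] [NormedSpace ℝ F] [CompleteSpace F]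
    {f : SimpleFunc β E} (hf : f.FinMeasSupp μ) {g : E → F} (hg : g 0 = 0) :
    ∫ x, g (f x) ∂μ = ∑ c ∈ f.range, μ.real (f ⁻¹' {c}) • g c := by
  rw [← SimpleFunc.map_integral f g (SimpleFunc.integrable_iff_finMeasSupp.2 hf) hg]
  exact ((f.map g).integral_eq_integral
    (SimpleFunc.integrable_iff_finMeasSupp.2 (hf.map hg))).symm

section RandomMeasure

variable {Ω : Type*} [MeasurableSpace Ω] {P : Measure Ω} {α : ℝ} {Λ : Set ℝ → Ω → ℝ}

namespace IsSaSRandomMeasure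

theorem empty_ae (hΛ : IsSaSRandomMeasure α P Λ) : ∀ᵐ ω ∂P, Λ ∅ ω = 0 := by
  have := hΛ.sigma_additive (fun _ ↦ ∅) (fun _ ↦ MeasurableSet.empty)
    (fun _ _ _ ↦ disjoint_bot_left) (by simp)
  rw [iUnion_empty] at this
  filter_upwards [this] with ω hω
  have step_tendsto : Tendsto (fun n : ℕ ↦ ∑ _i ∈ Finset.range (n + 1), Λ ∅ ω) atTop
      (𝓝 (Λ ∅ ω + Λ ∅ ω)) := by
    simpa only [Finset.sum_range_succ] using hω.add_const (Λ ∅ ω)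
  simpa using tendsto_nhds_unique step_tendsto ((tendsto_add_atTop_iff_nat 1).2 hω)

theorem union_ae (hΛ : IsSaSRandomMeasure α P Λ) {A B : Set ℝ} (hA : MeasurableSet A)
    (hB : MeasurableSet B) (hA_lt : volume A < ∞) (hB_lt : volume B < ∞) (hAB : Disjoint A B) :
    ∀ᵐ ω ∂P, Λ (A ∪ B) ω = Λ A ω + Λ B ω := by
  let S : ℕ → Set ℝ
    | 0 => A
    | 1 => B
    | _ + 2 => ∅
  have iUnion_S : ⋃ i, S i = A ∪ B := by
    rw [← union_iUnion_nat_succ, ← union_iUnion_nat_succ]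
    simp [S]
  have := hΛ.sigma_additive S
    (fun | 0 => hA | 1 => hB | _ + 2 => MeasurableSet.empty)
    (fun i j hij ↦ by
      match i, j with
      | 0, 0 | 1, 1 => exact absurd rfl hij
      | 0, 1 => exact hAB
      | 1, 0 => exact hAB.symm
      | _ + 2, _ => exact disjoint_bot_left
      | _, _ + 2 => exact disjoint_bot_right)
    (iUnion_S ▸ measure_union_lt_top hA_lt hB_lt)
  rw [iUnion_S] at this
  filter_upwards [this, hΛ.empty_ae] with ω hω h_empty
  refine tendsto_nhds_unique ((tendsto_add_atTop_iff_nat 2).2 hω) ?_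
  simp [Finset.sum_range_succ', S, h_empty, add_comm (Λ B ω)]

theorem biUnion_ae (hΛ : IsSaSRandomMeasure α P Λ) {ι : Type*} (s : Finset ι) {A : ι → Set ℝ}
    (hA : ∀ i ∈ s, MeasurableSet (A i)) (hA_lt : ∀ i ∈ s, volume (A i) < ∞)
    (hd : (s : Set ι).PairwiseDisjoint A) :
    ∀ᵐ ω ∂P, Λ (⋃ i ∈ s, A i) ω = ∑ i ∈ s, Λ (A i) ω := by
  classical
  induction s using Finset.induction_on with
  | empty => simpa using hΛ.empty_ae
  | insert i s hi ih =>
    simp only [Finset.forall_mem_insert] at hA hA_lt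
    rw [Finset.coe_insert, pairwiseDisjoint_insert_of_notMem (mod_cast hi)] at hd
    filter_upwards [ih hA.2 hA_lt.2 hd.1,
      hΛ.union_ae hA.1 (Finset.measurableSet_biUnion s hA.2) hA_lt.1
        (measure_biUnion_lt_top s.finite_toSet hA_lt.2)
        (disjoint_iUnion₂_right.2 hd.2)] with ω h_sum h_union
    rw [Finset.set_biUnion_insert, h_union, h_sum, Finset.sum_insert hi]

theorem iIndepFun_of_pairwise_disjoint (hΛ : IsSaSRandomMeasure α P Λ) {ι : Type*} [Finite ι]
    {A : ι → Set ℝ} (hA : ∀ i, MeasurableSet (A i)) (hA_lt : ∀ i, volume (A i) < ∞)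
    (hd : Pairwise (Function.onFun Disjoint A)) : iIndepFun (fun i ↦ Λ (A i)) P := by
  let e := Finite.equivFin ι
  have := hΛ.indep _ (A ∘ e.symm) (fun _ ↦ hA _) (fun _ ↦ hA_lt _)
    fun _ _ hij ↦ hd (e.symm.injective.ne hij)
  simpa using this.precomp e.injective

theorem charFun_map_sum_mul (hΛ : IsSaSRandomMeasure α P Λ) {ι : Type*} [Fintype ι]
    {A : ι → Set ℝ} (hA : ∀ i, MeasurableSet (A i)) (hA_lt : ∀ i, volume (A i) < ∞)
    (hd : Pairwise (Function.onFun Disjoint A)) (c : ι → ℝ) :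
    charFun (P.map fun ω ↦ ∑ i, c i * Λ (A i) ω) 1
      = (Real.exp (-∑ i, volume.real (A i) * |c i| ^ α) : ℝ) := by
  have h_meas (i) := hΛ.measurable (A i) (hA i) (hA_lt i)
  have h_indep : iIndepFun (fun i ω ↦ c i * Λ (A i) ω) P :=
    (hΛ.iIndepFun_of_pairwise_disjoint hA hA_lt hd).comp (fun i ↦ (c i * ·))
      fun i ↦ measurable_const_mul (c i)
  rw [h_indep.charFun_map_fun_sum_eq_prod fun i ↦ ((h_meas i).const_mul (c i)).aemeasurable,
    Finset.prod_apply, ← Finset.sum_neg_distrib, Real.exp_sum, Complex.ofReal_prod]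
  refine Finset.prod_congr rfl fun i _ ↦ ?_
  calc charFun (P.map fun ω ↦ c i * Λ (A i) ω) 1
      = charFun ((P.map (Λ (A i))).map (c i * ·)) 1 := by
        rw [Measure.map_map (measurable_const_mul _) (h_meas i), Function.comp_def]
    _ = (Real.exp (-(volume.real (A i) * |c i| ^ α)) : ℝ) := by
        rw [charFun_map_mul, mul_one, hΛ.charFun_eq _ (hA i) (hA_lt i), Measure.real]

theorem charFun_map_simpleStochInt (hΛ : IsSaSRandomMeasure α P Λ) (hα : α ≠ 0)
    {f : SimpleFunc ℝ ℝ} (hf : f.FinMeasSupp volume) :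
    charFun (P.map (simpleStochInt Λ f)) 1 = (Real.exp (-∫ x, |f x| ^ α) : ℝ) := by
  have sum_nonzero {φ : ℝ → ℝ} (hφ : φ 0 = 0) :
      ∑ c ∈ f.range, φ c = ∑ c : f.range.filter (· ≠ 0), φ c := by
    rw [Finset.sum_coe_sort _ φ, Finset.sum_filter_of_ne]
    rintro c - hc rfl
    exact hc hφ
  have stochInt_eq : simpleStochInt Λ f
      = fun ω ↦ ∑ c : f.range.filter (· ≠ 0), (c : ℝ) * Λ (f ⁻¹' {(c : ℝ)}) ω :=
    funext fun ω ↦ sum_nonzero (zero_mul _)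
  have h_zero : |(0 : ℝ)| ^ α = 0 := by simp [hα]
  rw [stochInt_eq, hΛ.charFun_map_sum_mul (fun _ ↦ f.measurableSet_fiber _)
      (fun c : f.range.filter (· ≠ 0) ↦
        hf.meas_preimage_singleton_ne_zero (Finset.mem_filter.1 c.2).2)
      (fun _ _ hcd ↦ (disjoint_singleton.2 (Subtype.coe_ne_coe.2 hcd)).preimage f),
    integral_comp_simpleFunc (g := fun c ↦ |c| ^ α) hf h_zero]
  simp only [smul_eq_mul, sum_nonzero (φ := fun c ↦ volume.real (f ⁻¹' {c}) * |c| ^ α)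
    (by rw [h_zero, mul_zero])]

theorem measurable_simpleStochInt (hΛ : IsSaSRandomMeasure α P Λ) {f : SimpleFunc ℝ ℝ}
    (hf : f.FinMeasSupp volume) : Measurable (simpleStochInt Λ f) := by
  refine Finset.measurable_fun_sum _ fun c _ ↦ ?_
  rcases eq_or_ne c 0 with rfl | hc
  · simp
  · exact (hΛ.measurable _ (f.measurableSet_fiber c)
      (hf.meas_preimage_singleton_ne_zero hc)).const_mul c

theorem simpleStochInt_map_ae (hΛ : IsSaSRandomMeasure α P Λ) {E : Type*} [Zero E]
    {f : SimpleFunc ℝ E} (hf : f.FinMeasSupp volume) {g : E → ℝ} (hg : g 0 = 0) :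
    ∀ᵐ ω ∂P, simpleStochInt Λ (f.map g) ω = ∑ b ∈ f.range, g b * Λ (f ⁻¹' {b}) ω := by
  classical
  have fiber_ae : ∀ c ∈ (f.map g).range, ∀ᵐ ω ∂P,
      c * Λ (f.map g ⁻¹' {c}) ω = c * ∑ b ∈ f.range with g b = c, Λ (f ⁻¹' {b}) ω := by
    intro c _
    rcases eq_or_ne c 0 with rfl | hc
    · simp
    have ne_zero : ∀ b ∈ f.range.filter (g · = c), b ≠ 0 := by
      rintro b hb rfl
      exact hc ((Finset.mem_filter.1 hb).2.symm.trans hg)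
    have preimage_eq : f.map g ⁻¹' {c} = ⋃ b ∈ f.range.filter (g · = c), f ⁻¹' {b} := by
      ext x
      simp
    filter_upwards [hΛ.biUnion_ae (f.range.filter (g · = c)) (A := fun b ↦ f ⁻¹' {b})
      (fun b _ ↦ f.measurableSet_fiber b)
      (fun b hb ↦ hf.meas_preimage_singleton_ne_zero (ne_zero b hb))
      (fun b _ b' _ hbb' ↦ (disjoint_singleton.2 hbb').preimage f)] with ω hω
    rw [preimage_eq, hω]
  filter_upwards [(ae_ball_iff (f.map g).range.countable_toSet).2 fiber_ae] with ω hω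
  rw [simpleStochInt, Finset.sum_congr rfl hω,
    ← Finset.sum_fiberwise_of_maps_to (s := f.range) (t := (f.map g).range) (g := g)
      fun b hb ↦ SimpleFunc.range_map g f ▸ Finset.mem_image_of_mem g hb]
  refine Finset.sum_congr rfl fun c _ ↦ ?_
  rw [Finset.mul_sum]
  exact Finset.sum_congr rfl fun b hb ↦ by rw [(Finset.mem_filter.1 hb).2]

theorem simpleStochInt_add_ae (hΛ : IsSaSRandomMeasure α P Λ) {f g : SimpleFunc ℝ ℝ}
    (hf : f.FinMeasSupp volume) (hg : g.FinMeasSupp volume) :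
    simpleStochInt Λ (f + g) =ᵐ[P] simpleStochInt Λ f + simpleStochInt Λ g := by
  have h_add := hΛ.simpleStochInt_map_ae (hf.pair hg) (g := fun p ↦ p.1 + p.2) (add_zero 0)
  have h_fst := hΛ.simpleStochInt_map_ae (hf.pair hg) (g := Prod.fst) rfl
  have h_snd := hΛ.simpleStochInt_map_ae (hf.pair hg) (g := Prod.snd) rfl
  filter_upwards [h_add, h_fst, h_snd] with ω h_add h_fst h_snd
  rw [SimpleFunc.map_fst_pair] at h_fst
  rw [SimpleFunc.map_snd_pair] at h_snd
  rw [Pi.add_apply, h_fst, h_snd, ← Finset.sum_add_distrib]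
  simp only [add_mul] at h_add
  exact h_add

theorem simpleStochInt_const_mul_ae (hΛ : IsSaSRandomMeasure α P Λ) {f : SimpleFunc ℝ ℝ}
    (hf : f.FinMeasSupp volume) (c : ℝ) :
    simpleStochInt Λ (f.map (c * ·)) =ᵐ[P] c • simpleStochInt Λ f := by
  filter_upwards [hΛ.simpleStochInt_map_ae hf (mul_zero c)] with ω hω
  rw [hω, Pi.smul_apply, simpleStochInt, smul_eq_mul, Finset.mul_sum]
  exact Finset.sum_congr rfl fun b _ ↦ mul_assoc _ _ _

end IsSaSRandomMeasure

end RandomMeasure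

section StochasticIntegral

variable {Ω : Type*} [MeasurableSpace Ω] {P : Measure Ω} {α : ℝ} {Λ : Set ℝ → Ω → ℝ}
  {f g : ℝ → ℝ} {Y Z : Ω → ℝ}

namespace IsStochInt

theorem aemeasurable (hΛ : IsSaSRandomMeasure α P Λ) (hY : IsStochInt α P Λ f Y) :
    AEMeasurable Y P := by
  obtain ⟨φ, hφ, -, hφY⟩ := hY
  exact hφY.aemeasurable fun n ↦ (hΛ.measurable_simpleStochInt (hφ n)).aemeasurable

theorem const_mul (hΛ : IsSaSRandomMeasure α P Λ) (hY : IsStochInt α P Λ f Y) (c : ℝ) :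
    IsStochInt α P Λ (fun x ↦ c * f x) (fun ω ↦ c * Y ω) := by
  obtain ⟨φ, hφ, hφf, hφY⟩ := hY
  refine ⟨fun n ↦ (φ n).map (c * ·), fun n ↦ (hφ n).map (mul_zero c), ?_,
    (tendstoInMeasure_const_smul hφY c).congr_left fun n ↦
      (hΛ.simpleStochInt_const_mul_ae (hφ n) c).symm⟩
  have abs_eq (n : ℕ) (x : ℝ) : ENNReal.ofReal (|(φ n).map (c * ·) x - c * f x| ^ α)
      = ENNReal.ofReal (|c| ^ α) * ENNReal.ofReal (|φ n x - f x| ^ α) := by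
    rw [SimpleFunc.map_apply, ← mul_sub, abs_mul, Real.mul_rpow (abs_nonneg _) (abs_nonneg _),
      ENNReal.ofReal_mul (by positivity)]
  simp only [abs_eq, lintegral_const_mul' _ _ ENNReal.ofReal_ne_top]
  simpa using ENNReal.Tendsto.const_mul hφf (Or.inr ENNReal.ofReal_ne_top)

theorem add (hΛ : IsSaSRandomMeasure α P Λ) (hα : 0 < α) (hf : AEMeasurable f)
    (hg : AEMeasurable g) (hY : IsStochInt α P Λ f Y) (hZ : IsStochInt α P Λ g Z) :
    IsStochInt α P Λ (fun x ↦ f x + g x) (fun ω ↦ Y ω + Z ω) := by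
  obtain ⟨φ, hφ, hφf, hφY⟩ := hY
  obtain ⟨ψ, hψ, hψg, hψZ⟩ := hZ
  refine ⟨fun n ↦ φ n + ψ n, fun n ↦ (hφ n).add (hψ n), ?_,
    (tendstoInMeasure_add hφY hψZ).congr_left fun n ↦
      (hΛ.simpleStochInt_add_ae (hφ n) (hψ n)).symm⟩
  simp only [← Real.norm_eq_abs, ofReal_norm_rpow hα.le] at hφf hψg ⊢
  simpa only [SimpleFunc.coe_add, Pi.add_apply, Pi.sub_apply, add_sub_add_comm] using
    tendsto_lintegral_enorm_add_rpow_zero hα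
      (fun n ↦ ((φ n).measurable.aemeasurable.sub hf).aestronglyMeasurable)
      (fun n ↦ ((ψ n).measurable.aemeasurable.sub hg).aestronglyMeasurable) hφf hψg

theorem zero (hα : α ≠ 0) : IsStochInt α P Λ (fun _ ↦ 0) (fun _ ↦ 0) := by
  have stochInt_zero : simpleStochInt Λ (0 : SimpleFunc ℝ ℝ) = 0 := by
    funext ω
    simp +contextual [simpleStochInt, ← SimpleFunc.const_zero, SimpleFunc.range_const]
  refine ⟨fun _ ↦ 0, fun _ ↦ ?_, by simp [hα], ?_⟩
  · simp [SimpleFunc.finMeasSupp_iff_support]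
  · simp only [stochInt_zero]
    exact tendstoInMeasure_iff_norm.2 fun ε hε ↦ by simp [hε.not_ge]

theorem sum (hΛ : IsSaSRandomMeasure α P Λ) (hα : 0 < α) {ι : Type*} (s : Finset ι)
    {f : ι → ℝ → ℝ} {Y : ι → Ω → ℝ} (hf : ∀ i ∈ s, AEMeasurable (f i))
    (hY : ∀ i ∈ s, IsStochInt α P Λ (f i) (Y i)) :
    IsStochInt α P Λ (fun x ↦ ∑ i ∈ s, f i x) (fun ω ↦ ∑ i ∈ s, Y i ω) := by
  classical
  induction s using Finset.induction_on with
  | empty => simpa using zero hα.ne'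
  | insert i s hi ih =>
    simp only [Finset.forall_mem_insert] at hf hY
    simp only [Finset.sum_insert hi]
    exact hY.1.add hΛ hα hf.1 (Finset.aemeasurable_fun_sum _ hf.2) (ih hf.2 hY.2)

theorem charFun_map_one [IsProbabilityMeasure P] (hΛ : IsSaSRandomMeasure α P Λ) (hα : 0 < α)
    (hf : MemLp f (ENNReal.ofReal α)) (hY : IsStochInt α P Λ f Y) :
    charFun (P.map Y) 1 = (Real.exp (-∫ x, |f x| ^ α) : ℝ) := by
  have hY_meas := hY.aemeasurable hΛ
  obtain ⟨φ, hφ, hφf, hφY⟩ := hY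
  simp only [← Real.norm_eq_abs, ofReal_norm_rpow hα.le] at hφf
  have law_tendsto := hφY.tendstoInDistribution_of_aemeasurable
    (fun n ↦ (hΛ.measurable_simpleStochInt (hφ n)).aemeasurable) hY_meas
  have charFun_tendsto := ProbabilityMeasure.tendsto_iff_tendsto_charFun.1 law_tendsto.tendsto 1
  refine tendsto_nhds_unique charFun_tendsto ?_
  simp only [ProbabilityMeasure.coe_mk, hΛ.charFun_map_simpleStochInt hα.ne' (hφ _)]
  have norm_tendsto := tendsto_integral_norm_rpow hα
    (fun n ↦ (φ n).measurable.aestronglyMeasurable) hf hφf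
  exact (Complex.continuous_ofReal.comp (Real.continuous_exp.comp continuous_neg)).tendsto _
    |>.comp norm_tendsto

end IsStochInt

end StochasticIntegral

theorem identDistrib_pi_of_charFun_map_sum {ι Ω Ω' : Type*} [Fintype ι] [MeasurableSpace Ω]
    [MeasurableSpace Ω'] {P : Measure Ω} {P' : Measure Ω'} [IsFiniteMeasure P] [IsFiniteMeasure P']
    {X : ι → Ω → ℝ} {Y : ι → Ω' → ℝ} (hX : ∀ i, AEMeasurable (X i) P)
    (hY : ∀ i, AEMeasurable (Y i) P')
    (h : ∀ c : ι → ℝ, charFun (P.map fun ω ↦ ∑ i, c i * X i ω) 1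
      = charFun (P'.map fun ω ↦ ∑ i, c i * Y i ω) 1) :
    IdentDistrib (fun ω i ↦ X i ω) (fun ω i ↦ Y i ω) P P' := by
  classical
  have hX' := aemeasurable_pi_lambda _ hX
  have hY' := aemeasurable_pi_lambda _ hY
  refine ⟨hX', hY', Measure.ext_of_charFunDual (funext fun L ↦ ?_)⟩
  obtain ⟨c, hc⟩ : ∃ c : ι → ℝ, ∀ x, L x = ∑ i, c i * x i :=
    ⟨fun i ↦ L fun j ↦ if i = j then 1 else 0, fun x ↦ by
      simpa [mul_comm] using L.toLinearMap.pi_apply_eq_sum_univ x⟩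
  rw [charFunDual_eq_charFun_map_one, charFunDual_eq_charFun_map_one,
    AEMeasurable.map_map_of_aemeasurable L.continuous.measurable.aemeasurable hX',
    AEMeasurable.map_map_of_aemeasurable L.continuous.measurable.aemeasurable hY']
  simpa only [Function.comp_def, hc] using h c

section MovingAverage

variable {Ω : Type*} [MeasurableSpace Ω] {P : Measure Ω} {α : ℝ} {m : ℝ → ℝ} {X : ℝ → Ω → ℝ}

theorem memLp_comp_const_sub {E : Type*} [NormedAddCommGroup E] {p : ℝ≥0∞} {f : ℝ → E}
    (hf : MemLp f p) (t : ℝ) : MemLp (fun x ↦ f (t - x)) p :=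
  hf.comp_measurePreserving (Measure.measurePreserving_sub_left volume t)

theorem IsSaSMovingAverage.aemeasurable (hX : IsSaSMovingAverage α P m X) (t : ℝ) :
    AEMeasurable (X t) P := by
  obtain ⟨Λ, hΛ, hX⟩ := hX
  exact (hX t).aemeasurable hΛ

theorem IsSaSMovingAverage.charFun_map_sum [IsProbabilityMeasure P]
    (hX : IsSaSMovingAverage α P m X) (hα : 0 < α) (hm : MemLp m (ENNReal.ofReal α)) {ι : Type*}
    (s : Finset ι) (c t : ι → ℝ) :
    charFun (P.map fun ω ↦ ∑ i ∈ s, c i * X (t i) ω) 1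
      = (Real.exp (-∫ x, |∑ i ∈ s, c i * m (t i - x)| ^ α) : ℝ) := by
  obtain ⟨Λ, hΛ, hX⟩ := hX
  have kernel_memLp (i : ι) : MemLp (fun x ↦ c i * m (t i - x)) (ENNReal.ofReal α) :=
    (memLp_comp_const_sub hm (t i)).const_mul (c i)
  exact (IsStochInt.sum hΛ hα s (fun i _ ↦ (kernel_memLp i).1.aemeasurable)
    fun i _ ↦ (hX (t i)).const_mul hΛ (c i)).charFun_map_one hΛ hα
      (memLp_finsetSum s fun i _ ↦ kernel_memLp i)

theorem IsSaSMovingAverage.isStationaryProcess [IsProbabilityMeasure P]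
    (hX : IsSaSMovingAverage α P m X) (hα : 0 < α) (hm : MemLp m (ENNReal.ofReal α)) :
    IsStationaryProcess P X := by
  intro n t h
  refine identDistrib_pi_of_charFun_map_sum (fun i ↦ hX.aemeasurable (t i + h))
    (fun i ↦ hX.aemeasurable (t i)) fun c ↦ ?_
  rw [hX.charFun_map_sum hα hm _ c fun i ↦ t i + h, hX.charFun_map_sum hα hm,
    ← integral_add_right_eq_self (fun x ↦ |∑ i, c i * m (t i + h - x)| ^ α) h]
  simp only [add_sub_add_right_eq_sub]

end MovingAverage

section CovarianceOfAverages

variable {Ω : Type*} [MeasurableSpace Ω] {P : Measure Ω} [IsProbabilityMeasure P]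

theorem covariance_eq_integral_mul_sub {W Z : Ω → ℝ} (hZ : Integrable Z P)
    (hWZ : Integrable (fun ω ↦ W ω * (Z ω - P[Z])) P) :
    cov[W, Z; P] = ∫ ω, W ω * (Z ω - P[Z]) ∂P := by
  have hZ_sub : Integrable (fun ω ↦ Z ω - P[Z]) P := hZ.sub (integrable_const _)
  have centered : ∫ ω, Z ω - P[Z] ∂P = 0 := by simp [integral_sub hZ]
  simp only [covariance, sub_mul]
  rw [integral_sub hWZ (hZ_sub.const_mul _), integral_const_mul, centered, mul_zero, sub_zero]

theorem covariance_integral_left {S E : Type*} [MeasurableSpace S] [MeasurableSpace E]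
    {ρ : Measure S} [SFinite ρ] {K : S → E → ℝ} (hK : Measurable (Function.uncurry K))
    {g : S → ℝ} (hg : Integrable g ρ) (hKg : ∀ u x, |K u x| ≤ g u) {X : Ω → E}
    (hX : AEMeasurable X P) {Z : Ω → ℝ} (hZ : Integrable Z P) :
    Integrable (fun u ↦ cov[fun ω ↦ K u (X ω), Z; P]) ρ ∧
      cov[fun ω ↦ ∫ u, K u (X ω) ∂ρ, Z; P] = ∫ u, cov[fun ω ↦ K u (X ω), Z; P] ∂ρ := by
  have hZ_sub : Integrable (fun ω ↦ Z ω - P[Z]) P := hZ.sub (integrable_const _)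
  have joint_integrable :
      Integrable (fun p : S × Ω ↦ K p.1 (X p.2) * (Z p.2 - P[Z])) (ρ.prod P) := by
    have hKX : AEMeasurable (fun p : S × Ω ↦ K p.1 (X p.2)) (ρ.prod P) :=
      hK.comp_aemeasurable (measurable_fst.aemeasurable.prodMk hX.comp_snd)
    refine (hg.mul_prod hZ_sub.norm).mono'
      (hKX.aestronglyMeasurable.mul hZ_sub.1.comp_snd) (ae_of_all _ fun p ↦ ?_)
    rw [norm_mul]
    exact mul_le_mul_of_nonneg_right (hKg _ _) (norm_nonneg _)
  have cov_eq (u : S) : cov[fun ω ↦ K u (X ω), Z; P] = ∫ ω, K u (X ω) * (Z ω - P[Z]) ∂P :=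
    covariance_eq_integral_mul_sub hZ (hZ_sub.bdd_mul
      (hK.of_uncurry_left.comp_aemeasurable hX).aestronglyMeasurable
      (ae_of_all _ fun ω ↦ hKg u (X ω)))
  have average_integrable := joint_integrable.integral_prod_right
  simp only [integral_mul_const] at average_integrable
  simp only [cov_eq]
  refine ⟨joint_integrable.integral_prod_left, ?_⟩
  rw [integral_integral_swap joint_integrable, covariance_eq_integral_mul_sub hZ average_integrable]
  simp only [integral_mul_const]

end CovarianceOfAverages

section Hoeffding

variable {Ω : Type*} [MeasurableSpace Ω] {P : Measure Ω} [IsProbabilityMeasure P]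
  {F G : ℝ → ℝ} {X Y : Ω → ℝ}

theorem integral_deriv_mul_indicator_Ioi (hF : Differentiable ℝ F) (hF' : Integrable (deriv F))
    (hF_lim : Tendsto F atBot (𝓝 0)) (x : ℝ) :
    ∫ u, deriv F u * (Ioi u).indicator (fun _ ↦ 1) x = F x := by
  have integrand_eq (u : ℝ) :
      deriv F u * (Ioi u).indicator (fun _ ↦ 1) x = (Iio x).indicator (deriv F) u := by
    simp [indicator_apply]
  simp only [integrand_eq]
  rw [integral_indicator measurableSet_Iio, ← integral_Iic_eq_integral_Iio,
    integral_Iic_of_hasDerivAt_of_tendsto' (fun u _ ↦ (hF u).hasDerivAt) hF'.integrableOn hF_lim,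
    sub_zero]

theorem abs_mul_indicator_Ioi_le (c u x : ℝ) :
    |c * (Ioi u).indicator (fun _ ↦ 1) x| ≤ |c| := by
  by_cases h : u < x <;> simp [h]

theorem measurable_deriv_mul_indicator_Ioi (F : ℝ → ℝ) :
    Measurable (Function.uncurry fun u x ↦ deriv F u * (Ioi u).indicator (fun _ ↦ (1 : ℝ)) x) :=
  ((measurable_deriv F).comp measurable_fst).mul
    ((measurable_const (a := (1 : ℝ))).indicator (measurableSet_lt measurable_fst measurable_snd))

theorem covariance_comp_eq_integral (hF : Differentiable ℝ F) (hF' : Integrable (deriv F))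
    (hF_lim : Tendsto F atBot (𝓝 0)) (hG : Differentiable ℝ G) (hG' : Integrable (deriv G))
    (hG_lim : Tendsto G atBot (𝓝 0)) (hX : AEMeasurable X P) (hY : AEMeasurable Y P) :
    cov[F ∘ X, G ∘ Y; P] = ∫ v, deriv G v * ∫ u, deriv F u *
      cov[{ω | X ω > u}.indicator fun _ ↦ 1, {ω | Y ω > v}.indicator fun _ ↦ 1; P] := by
  have F_eq := integral_deriv_mul_indicator_Ioi hF hF' hF_lim
  have G_eq := integral_deriv_mul_indicator_Ioi hG hG' hG_lim
  have hFX : Integrable (F ∘ X) P := by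
    refine .of_bound (hF.continuous.measurable.comp_aemeasurable hX).aestronglyMeasurable
      (∫ u, |deriv F u|) (ae_of_all _ fun ω ↦ ?_)
    rw [Function.comp_apply, ← F_eq]
    exact norm_integral_le_of_norm_le hF'.abs
      (ae_of_all _ fun u ↦ abs_mul_indicator_Ioi_le (deriv F u) u (X ω))
  have excursion_integrable (v : ℝ) :
      Integrable (fun ω ↦ (Ioi v).indicator (fun _ ↦ (1 : ℝ)) (Y ω)) P :=
    .of_bound (((measurable_const.indicator measurableSet_Ioi).comp_aemeasurable
      hY).aestronglyMeasurable) 1 (ae_of_all _ fun ω ↦ norm_indicator_le_norm_self _ _ |>.trans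
        (by simp))
  have average_X (v : ℝ) := (covariance_integral_left (measurable_deriv_mul_indicator_Ioi F)
    hF'.abs (fun u ↦ abs_mul_indicator_Ioi_le (deriv F u) u) hX (excursion_integrable v)).2
  have average_Y := (covariance_integral_left (measurable_deriv_mul_indicator_Ioi G) hG'.abs
    (fun v ↦ abs_mul_indicator_Ioi_le (deriv G v) v) hY hFX).2
  simp only [F_eq, G_eq, covariance_const_mul_left] at average_X average_Y
  calc cov[F ∘ X, G ∘ Y; P]
      = ∫ v, deriv G v * cov[F ∘ X, fun ω ↦ (Ioi v).indicator (fun _ ↦ 1) (Y ω); P] := by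
        simp only [covariance_comm _ (F ∘ X)] at average_Y
        exact average_Y
    _ = _ := by
        refine integral_congr_ae (ae_of_all _ fun v ↦ ?_)
        exact congrArg (deriv G v * ·) (average_X v)

theorem enorm_integral_mul_le_lintegral_withDensity {β : Type*} [MeasurableSpace β]
    {μ : Measure β} {f : β → ℝ} (hf : Measurable f) (g : β → ℝ) :
    ‖∫ x, f x * g x ∂μ‖ₑ ≤ ∫⁻ x, ‖g x‖ₑ ∂(μ.withDensity fun x ↦ ‖f x‖ₑ) := by
  rw [lintegral_withDensity_eq_lintegral_mul_non_measurable _ hf.enorm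
    (ae_of_all _ fun _ ↦ enorm_lt_top)]
  simpa only [Pi.mul_apply, enorm_mul] using enorm_integral_le_lintegral_enorm (μ := μ) (f * g)

theorem enorm_covariance_comp_le (hF : Differentiable ℝ F) (hF' : Integrable (deriv F))
    (hF_lim : Tendsto F atBot (𝓝 0)) (hG : Differentiable ℝ G) (hG' : Integrable (deriv G))
    (hG_lim : Tendsto G atBot (𝓝 0)) (hX : AEMeasurable X P) (hY : AEMeasurable Y P) :
    ‖cov[F ∘ X, G ∘ Y; P]‖ₑ ≤ ∫⁻ v, ∫⁻ u,
        ‖cov[{ω | X ω > u}.indicator fun _ ↦ 1, {ω | Y ω > v}.indicator fun _ ↦ 1; P]‖ₑ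
      ∂(volume.withDensity fun u ↦ ‖deriv F u‖ₑ) ∂(volume.withDensity fun v ↦ ‖deriv G v‖ₑ) := by
  rw [covariance_comp_eq_integral hF hF' hF_lim hG hG' hG_lim hX hY]
  refine (enorm_integral_mul_le_lintegral_withDensity (measurable_deriv G) _).trans ?_
  gcongr with v
  exact enorm_integral_mul_le_lintegral_withDensity (measurable_deriv F) _

end Hoeffding

section LongRangeDependence

variable {Ω : Type*} [MeasurableSpace Ω] {P : Measure Ω} {X : ℝ → Ω → ℝ}

theorem IsStationaryProcess.aemeasurable (hX : IsStationaryProcess P X) (t : ℝ) :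
    AEMeasurable (X t) P :=
  (measurable_pi_apply 0).comp_aemeasurable (hX 1 (fun _ ↦ t) 0).aemeasurable_snd

theorem IsStationaryProcess.isLongRangeDependent [IsProbabilityMeasure P]
    (hX : IsStationaryProcess P X) {F : ℝ → ℝ} (hF : Differentiable ℝ F)
    (hF' : Integrable (deriv F)) (hF_lim : Tendsto F atBot (𝓝 0))
    (hcov : ∫⁻ t, ‖cov[F ∘ X 0, F ∘ X t; P]‖ₑ = ∞) : IsLongRangeDependent P X := by
  refine ⟨hX, volume.withDensity fun u ↦ ‖deriv F u‖ₑ,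
    isFiniteMeasure_withDensity hF'.2.ne, top_unique ?_⟩
  rw [← hcov]
  gcongr with t
  simpa only [excursionCov, ← Real.enorm_eq_ofReal_abs] using
    enorm_covariance_comp_le hF hF' hF_lim hF hF' hF_lim (hX.aemeasurable 0) (hX.aemeasurable t)

end LongRangeDependence

section CosineCovariance

variable {Ω : Type*} [MeasurableSpace Ω] {P : Measure Ω} [IsProbabilityMeasure P] {α : ℝ}

theorem integrable_abs_rpow_of_memLp {β : Type*} [MeasurableSpace β] {μ : Measure β} (hα : 0 < α)
    {f : β → ℝ} (hf : MemLp f (ENNReal.ofReal α) μ) : Integrable (fun x ↦ |f x| ^ α) μ := by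
  simpa [ENNReal.toReal_ofReal hα.le] using
    hf.integrable_norm_rpow (by simpa using hα) ENNReal.ofReal_ne_top

theorem integrable_min_abs_rpow {β : Type*} [MeasurableSpace β] {μ : Measure β} (hα : 0 < α)
    {f g : β → ℝ} (hf : MemLp f (ENNReal.ofReal α) μ) (hg : AEMeasurable g μ) :
    Integrable (fun x ↦ min |f x| |g x| ^ α) μ := by
  refine (integrable_abs_rpow_of_memLp hα hf).mono'
    ((hf.1.aemeasurable.norm.min hg.norm).pow_const α).aestronglyMeasurable (ae_of_all _ fun x ↦ ?_)
  have min_nonneg : 0 ≤ min |f x| |g x| := le_min (abs_nonneg _) (abs_nonneg _)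
  rw [Real.norm_of_nonneg (Real.rpow_nonneg min_nonneg α)]
  exact Real.rpow_le_rpow min_nonneg (min_le_left _ _) hα.le

theorem integral_abs_add_rpow_add_integral_abs_sub_rpow_le {β : Type*} [MeasurableSpace β]
    {μ : Measure β} (hα0 : 0 < α) (hα2 : α ≤ 2) {f g : β → ℝ}
    (hf : MemLp f (ENNReal.ofReal α) μ) (hg : MemLp g (ENNReal.ofReal α) μ) :
    (∫ x, |f x + g x| ^ α ∂μ + ∫ x, |f x - g x| ^ α ∂μ) / 2 +
        (2 - 2 ^ (α / 2)) * ∫ x, min |f x| |g x| ^ α ∂μ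
      ≤ ∫ x, |f x| ^ α ∂μ + ∫ x, |g x| ^ α ∂μ := by
  have hf_int := integrable_abs_rpow_of_memLp hα0 hf
  have hg_int := integrable_abs_rpow_of_memLp hα0 hg
  have hadd_int : Integrable (fun x ↦ |f x + g x| ^ α) μ :=
    integrable_abs_rpow_of_memLp hα0 (hf.add hg)
  have hsub_int : Integrable (fun x ↦ |f x - g x| ^ α) μ :=
    integrable_abs_rpow_of_memLp hα0 (hf.sub hg)
  have hmin_int := integrable_min_abs_rpow hα0 hf hg.1.aemeasurable
  have pointwise (x : β) := abs_add_rpow_add_abs_sub_rpow_le hα0.le hα2 (f x) (g x)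
  have integrated := integral_mono
    (((hadd_int.add hsub_int).div_const 2).add (hmin_int.const_mul (2 - 2 ^ (α / 2))))
    (hf_int.add hg_int) pointwise
  rwa [integral_add' ((hadd_int.add hsub_int).div_const 2) (hmin_int.const_mul _), integral_div,
    integral_add' hadd_int hsub_int, integral_const_mul, integral_add' hf_int hg_int] at integrated

theorem exp_neg_half_add_le (p q : ℝ) :
    Real.exp (-((p + q) / 2)) ≤ (Real.exp (-p) + Real.exp (-q)) / 2 := by
  have exp_half_sq (x : ℝ) : Real.exp (-x / 2) ^ 2 = Real.exp (-x) := by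
    rw [← Real.exp_nat_mul]
    ring_nf
  calc Real.exp (-((p + q) / 2))
      = Real.exp (-p / 2) * Real.exp (-q / 2) := by rw [← Real.exp_add]; ring_nf
    _ ≤ (Real.exp (-p / 2) ^ 2 + Real.exp (-q / 2) ^ 2) / 2 := by
        linarith [two_mul_le_add_sq (Real.exp (-p / 2)) (Real.exp (-q / 2))]
    _ = _ := by rw [exp_half_sq, exp_half_sq]

theorem exp_neg_mul_le_of_half_add_add_le {p q δ A : ℝ} (h : (p + q) / 2 + δ ≤ A) :
    Real.exp (-A) * δ ≤ (Real.exp (-p) + Real.exp (-q)) / 2 - Real.exp (-A) := by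
  have : Real.exp (-A) * (δ + 1) ≤ (Real.exp (-p) + Real.exp (-q)) / 2 :=
    calc Real.exp (-A) * (δ + 1)
        ≤ Real.exp (-A) * Real.exp δ := by gcongr; exact Real.add_one_le_exp δ
      _ = Real.exp (-A + δ) := (Real.exp_add _ _).symm
      _ ≤ Real.exp (-((p + q) / 2)) := Real.exp_le_exp.2 (by linarith)
      _ ≤ _ := exp_neg_half_add_le p q
  linarith

theorem integral_cos_eq_re_charFun {Z : Ω → ℝ} (hZ : AEMeasurable Z P) :
    ∫ ω, Real.cos (Z ω) ∂P = (charFun (P.map Z) 1).re := by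
  have exp_integrable : Integrable (fun ω ↦ Complex.exp (Z ω * Complex.I)) P :=
    .of_bound (AEMeasurable.aestronglyMeasurable (by fun_prop)) 1
      (ae_of_all _ fun ω ↦ (Complex.norm_exp_ofReal_mul_I (Z ω)).le)
  rw [charFun_apply_real, integral_map hZ (by fun_prop)]
  simpa [Complex.exp_ofReal_mul_I_re] using integral_re exp_integrable

theorem integral_cos_mul_gaussianReal (x : ℝ) :
    ∫ s, Real.cos (s * x) ∂(gaussianReal 0 1) = Real.exp (-x ^ 2 / 2) := by
  have charFun_map : charFun ((gaussianReal 0 1).map fun s ↦ x * s) 1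
      = (Real.exp (-x ^ 2 / 2) : ℝ) := by
    rw [charFun_map_mul, mul_one, charFun_gaussianReal]
    push_cast
    congr 1
    simp only [mul_zero, zero_mul, one_mul]
    ring
  simp only [mul_comm _ x]
  rw [integral_cos_eq_re_charFun (by fun_prop), charFun_map, Complex.ofReal_re]

theorem integral_mul_le_covariance_exp_neg_sq_half {w : ℝ → ℝ}
    (hw : Integrable w (gaussianReal 0 1)) {Y Z : Ω → ℝ} (hY : AEMeasurable Y P)
    (hZ : Integrable Z P) {c : ℝ} (h : ∀ s, w s * c ≤ cov[fun ω ↦ Real.cos (s * Y ω), Z; P]) :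
    (∫ s, w s ∂(gaussianReal 0 1)) * c ≤ cov[fun ω ↦ Real.exp (-Y ω ^ 2 / 2), Z; P] := by
  have cos_measurable : Measurable (Function.uncurry fun s x : ℝ ↦ Real.cos (s * x)) := by
    unfold Function.uncurry
    fun_prop
  obtain ⟨cov_integrable, cov_eq⟩ := covariance_integral_left (ρ := gaussianReal 0 1) cos_measurable
    (integrable_const (1 : ℝ)) (fun _ _ ↦ Real.abs_cos_le_one _) hY hZ
  simp only [integral_cos_mul_gaussianReal] at cov_eq
  rw [cov_eq, ← integral_mul_const]
  exact integral_mono (hw.mul_const c) cov_integrable h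

theorem covariance_cos_cos {Y Z : Ω → ℝ} (hY : AEMeasurable Y P) (hZ : AEMeasurable Z P) :
    cov[fun ω ↦ Real.cos (Y ω), fun ω ↦ Real.cos (Z ω); P] =
      (∫ ω, Real.cos (Y ω + Z ω) ∂P + ∫ ω, Real.cos (Y ω - Z ω) ∂P) / 2 -
        (∫ ω, Real.cos (Y ω) ∂P) * ∫ ω, Real.cos (Z ω) ∂P := by
  have memLp_cos {W : Ω → ℝ} (hW : AEMeasurable W P) :
      MemLp (fun ω ↦ Real.cos (W ω)) 2 P :=
    .of_bound (Real.measurable_cos.comp_aemeasurable hW).aestronglyMeasurable 1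
      (ae_of_all _ fun ω ↦ Real.abs_cos_le_one _)
  have hadd : Integrable (fun ω ↦ Real.cos (Y ω + Z ω)) P :=
    (memLp_cos (hY.add hZ)).integrable one_le_two
  have hsub : Integrable (fun ω ↦ Real.cos (Y ω - Z ω)) P :=
    (memLp_cos (hY.sub hZ)).integrable one_le_two
  rw [covariance_eq_sub (memLp_cos hY) (memLp_cos hZ), ← integral_add hadd hsub,
    ← integral_div]
  congr 2 with ω
  simp only [Pi.mul_apply, Real.cos_add, Real.cos_sub]
  ring

theorem mul_min_abs_rpow_le_min_abs_mul_rpow (hα : 0 ≤ α) (s r x y : ℝ) :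
    min |s| 1 ^ α * min |r| 1 ^ α * min |x| |y| ^ α ≤ min |s * x| |r * y| ^ α := by
  rw [← Real.mul_rpow (by positivity) (by positivity),
    ← Real.mul_rpow (by positivity) (by positivity), abs_mul, abs_mul]
  refine Real.rpow_le_rpow (by positivity) (le_min ?_ ?_) hα
  · calc min |s| 1 * min |r| 1 * min |x| |y| ≤ |s| * 1 * |x| := by
          gcongr
          exacts [min_le_left _ _, min_le_right _ _, min_le_left _ _]
      _ = |s| * |x| := by rw [mul_one]
  · calc min |s| 1 * min |r| 1 * min |x| |y| ≤ 1 * |r| * |y| := by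
          gcongr
          exacts [min_le_right _ _, min_le_left _ _, min_le_right _ _]
      _ = |r| * |y| := by rw [one_mul]

/-- A lower bound, up to a constant factor, for the contribution of the frequency `s` to the
covariance of the cosines of two stochastic integrals; `A` stands for the integral of the `α`-th
power of the absolute value of the integrand. -/
noncomputable def cosWeight (α A s : ℝ) : ℝ := Real.exp (-(|s| ^ α * A)) * min |s| 1 ^ α

theorem integrable_cosWeight {γ : Measure ℝ} [IsFiniteMeasure γ] {A : ℝ} (hα : 0 ≤ α)
    (hA : 0 ≤ A) : Integrable (cosWeight α A) γ := by
  refine .of_bound (Measurable.aestronglyMeasurable (by unfold cosWeight; fun_prop)) 1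
    (ae_of_all _ fun s ↦ ?_)
  rw [cosWeight, Real.norm_of_nonneg (by positivity)]
  exact mul_le_one₀ (Real.exp_le_one_iff.2 (neg_nonpos.2 (by positivity))) (by positivity)
    (Real.rpow_le_one (by positivity) (min_le_right _ _) hα)

theorem integral_cosWeight_pos {γ : Measure ℝ} [IsFiniteMeasure γ] [γ.IsOpenPosMeasure] {A : ℝ}
    (hα : 0 ≤ α) (hA : 0 ≤ A) : 0 < ∫ s, cosWeight α A s ∂γ := by
  have cosWeight_continuous : Continuous (cosWeight α A) := by
    unfold cosWeight
    fun_prop (disch := exact fun _ ↦ .inr hα)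
  refine integral_pos_of_integrable_nonneg_nonzero (x := 1) cosWeight_continuous
    (integrable_cosWeight hα hA) (fun s ↦ ?_) ?_
  · rw [Pi.zero_apply, cosWeight]
    positivity
  · simp [cosWeight, Real.exp_ne_zero]

namespace IsStochInt

variable {Λ : Set ℝ → Ω → ℝ} {f g : ℝ → ℝ} {Y Z : Ω → ℝ}

theorem integral_cos (hΛ : IsSaSRandomMeasure α P Λ) (hα : 0 < α)
    (hf : MemLp f (ENNReal.ofReal α)) (hY : IsStochInt α P Λ f Y) :
    ∫ ω, Real.cos (Y ω) ∂P = Real.exp (-∫ x, |f x| ^ α) := by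
  rw [integral_cos_eq_re_charFun (hY.aemeasurable hΛ), hY.charFun_map_one hΛ hα hf,
    Complex.ofReal_re]

theorem le_covariance_cos (hΛ : IsSaSRandomMeasure α P Λ) (hα0 : 0 < α) (hα2 : α ≤ 2)
    (hf : MemLp f (ENNReal.ofReal α)) (hg : MemLp g (ENNReal.ofReal α))
    (hY : IsStochInt α P Λ f Y) (hZ : IsStochInt α P Λ g Z) :
    Real.exp (-((∫ x, |f x| ^ α) + ∫ x, |g x| ^ α)) *
        ((2 - 2 ^ (α / 2)) * ∫ x, min |f x| |g x| ^ α)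
      ≤ cov[fun ω ↦ Real.cos (Y ω), fun ω ↦ Real.cos (Z ω); P] := by
  have hadd := hY.add hΛ hα0 hf.1.aemeasurable hg.1.aemeasurable hZ
  have hsub := hY.add hΛ hα0 hf.1.aemeasurable (hg.1.aemeasurable.const_mul (-1))
    (hZ.const_mul hΛ (-1))
  simp only [neg_one_mul, ← sub_eq_add_neg] at hsub
  rw [covariance_cos_cos (hY.aemeasurable hΛ) (hZ.aemeasurable hΛ),
    hadd.integral_cos hΛ hα0 (hf.add hg), hsub.integral_cos hΛ hα0 (hf.sub hg),
    hY.integral_cos hΛ hα0 hf, hZ.integral_cos hΛ hα0 hg, ← Real.exp_add, ← neg_add]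
  exact exp_neg_mul_le_of_half_add_add_le
    (integral_abs_add_rpow_add_integral_abs_sub_rpow_le hα0 hα2 hf hg)

theorem le_covariance_cos_mul (hΛ : IsSaSRandomMeasure α P Λ) (hα0 : 0 < α) (hα2 : α ≤ 2)
    (hf : MemLp f (ENNReal.ofReal α)) (hg : MemLp g (ENNReal.ofReal α))
    (hY : IsStochInt α P Λ f Y) (hZ : IsStochInt α P Λ g Z) (s r : ℝ) :
    cosWeight α (∫ x, |f x| ^ α) s * cosWeight α (∫ x, |g x| ^ α) r *
        ((2 - 2 ^ (α / 2)) * ∫ x, min |f x| |g x| ^ α)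
      ≤ cov[fun ω ↦ Real.cos (s * Y ω), fun ω ↦ Real.cos (r * Z ω); P] := by
  have integral_abs_mul_rpow (c : ℝ) (h : ℝ → ℝ) :
      ∫ x, |c * h x| ^ α = |c| ^ α * ∫ x, |h x| ^ α := by
    simp only [abs_mul, Real.mul_rpow (abs_nonneg _) (abs_nonneg _), integral_const_mul]
  have overlap_le : min |s| 1 ^ α * min |r| 1 ^ α * ∫ x, min |f x| |g x| ^ α
      ≤ ∫ x, min |s * f x| |r * g x| ^ α := by
    rw [← integral_const_mul]
    exact integral_mono ((integrable_min_abs_rpow hα0 hf hg.1.aemeasurable).const_mul _)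
      (integrable_min_abs_rpow hα0 (hf.const_mul s) (hg.1.aemeasurable.const_mul r))
      fun x ↦ mul_min_abs_rpow_le_min_abs_mul_rpow hα0.le s r (f x) (g x)
  have two_sub_nonneg : (0 : ℝ) ≤ 2 - 2 ^ (α / 2) := by
    simpa using Real.rpow_le_rpow_of_exponent_le one_le_two (show α / 2 ≤ 1 by linarith)
  have unscaled := (hY.const_mul hΛ s).le_covariance_cos hΛ hα0 hα2 (hf.const_mul s)
    (hg.const_mul r) (hZ.const_mul hΛ r)
  rw [integral_abs_mul_rpow, integral_abs_mul_rpow] at unscaled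
  refine le_trans ?_ unscaled
  calc _ = Real.exp (-(|s| ^ α * (∫ x, |f x| ^ α) + |r| ^ α * ∫ x, |g x| ^ α)) *
        ((2 - 2 ^ (α / 2)) * (min |s| 1 ^ α * min |r| 1 ^ α * ∫ x, min |f x| |g x| ^ α)) := by
        rw [cosWeight, cosWeight, neg_add, Real.exp_add]
        ring
    _ ≤ _ := by gcongr

theorem le_covariance_exp_neg_sq_half (hΛ : IsSaSRandomMeasure α P Λ) (hα0 : 0 < α) (hα2 : α ≤ 2)
    (hf : MemLp f (ENNReal.ofReal α)) (hg : MemLp g (ENNReal.ofReal α))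
    (hY : IsStochInt α P Λ f Y) (hZ : IsStochInt α P Λ g Z) :
    (∫ s, cosWeight α (∫ x, |f x| ^ α) s ∂(gaussianReal 0 1)) *
        (∫ r, cosWeight α (∫ x, |g x| ^ α) r ∂(gaussianReal 0 1)) *
        ((2 - 2 ^ (α / 2)) * ∫ x, min |f x| |g x| ^ α)
      ≤ cov[fun ω ↦ Real.exp (-Y ω ^ 2 / 2), fun ω ↦ Real.exp (-Z ω ^ 2 / 2); P] := by
  have abs_rpow_nonneg (h : ℝ → ℝ) : 0 ≤ ∫ x, |h x| ^ α := integral_nonneg fun x ↦ by positivity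
  have hY_meas := hY.aemeasurable hΛ
  have hZ_meas := hZ.aemeasurable hΛ
  set c := (2 - 2 ^ (α / 2)) * ∫ x, min |f x| |g x| ^ α
  have average_Y (r : ℝ) : (∫ s, cosWeight α (∫ x, |f x| ^ α) s ∂(gaussianReal 0 1)) *
      (cosWeight α (∫ x, |g x| ^ α) r * c) ≤
        cov[fun ω ↦ Real.exp (-Y ω ^ 2 / 2), fun ω ↦ Real.cos (r * Z ω); P] := by
    refine integral_mul_le_covariance_exp_neg_sq_half
      (integrable_cosWeight hα0.le (abs_rpow_nonneg f)) hY_meas ?_ fun s ↦ ?_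
    · exact .of_bound (AEMeasurable.aestronglyMeasurable (by fun_prop)) 1
        (ae_of_all _ fun ω ↦ Real.abs_cos_le_one _)
    · rw [← mul_assoc]
      exact hY.le_covariance_cos_mul hΛ hα0 hα2 hf hg hZ s r
  rw [covariance_comm, mul_comm (∫ s, cosWeight α _ s ∂_), mul_assoc]
  refine integral_mul_le_covariance_exp_neg_sq_half
    (integrable_cosWeight hα0.le (abs_rpow_nonneg g)) hZ_meas ?_ fun r ↦ ?_
  · refine .of_bound (AEMeasurable.aestronglyMeasurable (by fun_prop)) 1 (ae_of_all _ fun ω ↦ ?_)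
    rw [Real.norm_eq_abs, Real.abs_exp, Real.exp_le_one_iff]
    linarith [sq_nonneg (Y ω)]
  · rw [covariance_comm]
    calc _ = _ := by ring
      _ ≤ _ := average_Y r

end IsStochInt

end CosineCovariance

section GaussianBump

theorem hasDerivAt_exp_neg_sq_half (x : ℝ) :
    HasDerivAt (fun x : ℝ ↦ Real.exp (-x ^ 2 / 2)) (-x * Real.exp (-x ^ 2 / 2)) x := by
  have hasDerivAt_exponent : HasDerivAt (fun x : ℝ ↦ -x ^ 2 / 2) (-x) x :=
    ((hasDerivAt_pow 2 x).neg.div_const 2).congr_deriv <| by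
      simp only [Nat.cast_ofNat, Nat.add_one_sub_one, pow_one]
      ring
  simpa only [mul_comm] using hasDerivAt_exponent.exp

theorem integrable_deriv_exp_neg_sq_half :
    Integrable (deriv fun x : ℝ ↦ Real.exp (-x ^ 2 / 2)) := by
  rw [funext fun x ↦ (hasDerivAt_exp_neg_sq_half x).deriv]
  refine (integrable_mul_exp_neg_mul_sq (b := 1 / 2) (by norm_num)).neg.congr
    (ae_of_all _ fun x ↦ ?_)
  simp only [Pi.neg_apply, neg_mul]
  ring_nf

theorem tendsto_exp_neg_sq_half_atBot :
    Tendsto (fun x : ℝ ↦ Real.exp (-x ^ 2 / 2)) atBot (𝓝 0) := by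
  have sq_tendsto : Tendsto (fun x : ℝ ↦ x ^ 2) atBot atTop := by
    simpa [Function.comp_def] using
      (tendsto_pow_atTop (α := ℝ) two_ne_zero).comp tendsto_abs_atBot_atTop
  exact Real.tendsto_exp_atBot.comp
    ((tendsto_neg_atTop_atBot.comp sq_tendsto).atBot_div_const two_pos)

end GaussianBump

section FirstMoment

theorem lintegral_ofReal_sub_eq_lintegral_measure_Ioi (ν : Measure ℝ) (a : ℝ) :
    ∫⁻ x, ENNReal.ofReal (x - a) ∂ν = ∫⁻ t in Ioi 0, ν (Ioi (a + t)) := by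
  have layer_cake := lintegral_eq_lintegral_meas_lt ν (f := fun x ↦ max (x - a) 0)
    (ae_of_all _ fun x ↦ le_max_right _ _) (by fun_prop)
  simp only [ENNReal.ofReal_max, ENNReal.ofReal_zero, max_eq_left zero_le] at layer_cake
  rw [layer_cake]
  refine setLIntegral_congr_fun measurableSet_Ioi fun t ht ↦ ?_
  congr 1
  ext x
  simp [lt_sub_iff_add_lt', not_lt_of_gt (mem_Ioi.1 ht)]

theorem lintegral_ofReal_sub_eq_top {ν : Measure ℝ} [IsFiniteMeasure ν] {a : ℝ}
    (h : ∫⁻ x in Ioi a, ENNReal.ofReal x ∂ν = ∞) : ∫⁻ x, ENNReal.ofReal (x - a) ∂ν = ∞ := by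
  have le_add : ∞ ≤ ∫⁻ x, ENNReal.ofReal (x - a) ∂ν + ENNReal.ofReal a * ν univ :=
    calc ∞ = ∫⁻ x in Ioi a, ENNReal.ofReal x ∂ν := h.symm
      _ ≤ ∫⁻ x, ENNReal.ofReal x ∂ν := setLIntegral_le_lintegral _ _
      _ ≤ ∫⁻ x, ENNReal.ofReal (x - a) + ENNReal.ofReal a ∂ν := by
          gcongr with x
          simpa using ENNReal.ofReal_add_le (p := x - a) (q := a)
      _ = _ := by rw [lintegral_add_right _ measurable_const, lintegral_const]
  simpa [ENNReal.mul_eq_top] using top_unique le_add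

end FirstMoment

section Overlap

variable {α a : ℝ} {m : ℝ → ℝ}

/-- The overlap `∫ min (|m x|, |m (t + x)|) ^ α dx` of a kernel and its translate, which governs
the dependence between the values at times `0` and `t` of the moving average with kernel `m`. -/
noncomputable def kernelOverlap (α : ℝ) (m : ℝ → ℝ) (t : ℝ) : ℝ≥0∞ :=
  ∫⁻ x, ENNReal.ofReal (min |m x| |m (t + x)| ^ α)

theorem kernelOverlap_comp_neg (α : ℝ) (m : ℝ → ℝ) (t : ℝ) :
    kernelOverlap α (fun x ↦ m (-x)) t = kernelOverlap α m t := by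
  unfold kernelOverlap
  rw [← lintegral_sub_left_eq_self
    (fun x ↦ ENNReal.ofReal (min |m (-x)| |m (-(t + x))| ^ α)) (-t)]
  refine lintegral_congr fun x ↦ ?_
  rw [min_comm]
  congr 5 <;> ring

theorem IsSaSMovingAverage.exists_kernelOverlap_le_enorm_covariance {Ω : Type*}
    [MeasurableSpace Ω] {P : Measure Ω} [IsProbabilityMeasure P] {X : ℝ → Ω → ℝ}
    (hX : IsSaSMovingAverage α P m X) (hα0 : 0 < α) (hα2 : α < 2)
    (hm : MemLp m (ENNReal.ofReal α)) :
    ∃ κ : ℝ, 0 < κ ∧ ∀ t, ENNReal.ofReal κ * kernelOverlap α m t ≤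
      ‖cov[fun ω ↦ Real.exp (-X 0 ω ^ 2 / 2), fun ω ↦ Real.exp (-X t ω ^ 2 / 2); P]‖ₑ := by
  obtain ⟨Λ, hΛ, hX⟩ := hX
  have kernel_memLp := memLp_comp_const_sub hm
  set w := ∫ s, cosWeight α (∫ x, |m x| ^ α) s ∂(gaussianReal 0 1)
  have : (gaussianReal 0 1).IsOpenPosMeasure :=
    (gaussianReal_absolutelyContinuous' 0 one_ne_zero).isOpenPosMeasure
  have w_pos : 0 < w :=
    integral_cosWeight_pos hα0.le (integral_nonneg fun x ↦ by positivity)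
  have two_sub_pos : (0 : ℝ) < 2 - 2 ^ (α / 2) := two_sub_two_rpow_pos (by linarith)
  refine ⟨w * w * (2 - 2 ^ (α / 2)), by positivity, fun t ↦ ?_⟩
  have overlap_eq : kernelOverlap α m t
      = ENNReal.ofReal (∫ x, min |m (0 - x)| |m (t - x)| ^ α) := by
    rw [ofReal_integral_eq_lintegral_ofReal
      (integrable_min_abs_rpow hα0 (kernel_memLp 0) (kernel_memLp t).1.aemeasurable)
      (ae_of_all _ fun x ↦ by positivity), kernelOverlap, ← lintegral_neg_eq_self]
    simp only [sub_eq_add_neg, zero_add]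
  have covariance_ge := (hX 0).le_covariance_exp_neg_sq_half hΛ hα0 hα2.le (kernel_memLp 0)
    (kernel_memLp t) (hX t)
  simp only [integral_sub_left_eq_self (fun x ↦ |m x| ^ α)] at covariance_ge
  rw [overlap_eq, ← ENNReal.ofReal_mul (by positivity), mul_assoc, Real.enorm_eq_ofReal_abs]
  exact ENNReal.ofReal_le_ofReal (covariance_ge.trans (le_abs_self _))

theorem IsSaSMovingAverage.isLongRangeDependent {Ω : Type*} [MeasurableSpace Ω] {P : Measure Ω}
    [IsProbabilityMeasure P] {X : ℝ → Ω → ℝ} (hX : IsSaSMovingAverage α P m X) (hα0 : 0 < α)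
    (hα2 : α < 2) (hm : MemLp m (ENNReal.ofReal α)) (h : ∫⁻ t, kernelOverlap α m t = ∞) :
    IsLongRangeDependent P X := by
  obtain ⟨κ, hκ, covariance_ge⟩ := hX.exists_kernelOverlap_le_enorm_covariance hα0 hα2 hm
  refine (hX.isStationaryProcess hα0 hm).isLongRangeDependent
    (fun x ↦ (hasDerivAt_exp_neg_sq_half x).differentiableAt) integrable_deriv_exp_neg_sq_half
    tendsto_exp_neg_sq_half_atBot (top_unique ?_)
  calc ∞ = ∫⁻ t, ENNReal.ofReal κ * kernelOverlap α m t := by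
        rw [lintegral_const_mul' _ _ ENNReal.ofReal_ne_top, h, ENNReal.mul_top (by simpa)]
    _ ≤ _ := lintegral_mono covariance_ge

theorem setLIntegral_Ioi_le_kernelOverlap {t : ℝ} (hanti : AntitoneOn (fun x ↦ |m x|) (Ioi a))
    (ht : 0 ≤ t) : ∫⁻ x in Ioi (a + t), ENNReal.ofReal (|m x| ^ α) ≤ kernelOverlap α m t := by
  rw [← lintegral_indicator measurableSet_Ioi, ← lintegral_add_left_eq_self _ t]
  refine lintegral_mono fun x ↦ ?_
  by_cases hx : t + x ∈ Ioi (a + t)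
  · have hxa : a < x := by linarith [mem_Ioi.1 hx]
    have abs_le : |m (t + x)| ≤ |m x| := hanti hxa (show a < t + x by linarith) (by linarith)
    rw [indicator_of_mem hx, min_eq_right abs_le]
  · rw [indicator_of_notMem hx]
    exact zero_le

theorem lintegral_kernelOverlap_eq_top (hα : 0 < α) (hm : MemLp m (ENNReal.ofReal α))
    (hanti : AntitoneOn (fun x ↦ |m x|) (Ioi a))
    (h : RightMomentInfinite α (fun x ↦ |m x|) a) : ∫⁻ t, kernelOverlap α m t = ∞ := by
  have m_int := integrable_abs_rpow_of_memLp hα hm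
  have density_meas := m_int.1.aemeasurable.ennreal_ofReal
  let ν := volume.withDensity fun x ↦ ENNReal.ofReal (|m x| ^ α)
  have : IsFiniteMeasure ν := isFiniteMeasure_withDensity_ofReal m_int.2
  have first_moment_infinite : ∫⁻ x in Ioi a, ENNReal.ofReal x ∂ν = ∞ := by
    rw [setLIntegral_withDensity_eq_setLIntegral_mul_non_measurable₀ _ density_meas.restrict _
      measurableSet_Ioi (ae_of_all _ fun _ ↦ ENNReal.ofReal_lt_top), ← h]
    refine lintegral_congr fun x ↦ ?_
    rw [Pi.mul_apply, ENNReal.ofReal_mul' (by positivity), mul_comm]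
  refine top_unique ?_
  calc ∞ = ∫⁻ x, ENNReal.ofReal (x - a) ∂ν :=
        (lintegral_ofReal_sub_eq_top first_moment_infinite).symm
    _ = ∫⁻ t in Ioi 0, ν (Ioi (a + t)) := lintegral_ofReal_sub_eq_lintegral_measure_Ioi ν a
    _ ≤ ∫⁻ t in Ioi 0, kernelOverlap α m t := by
        refine setLIntegral_mono' measurableSet_Ioi fun t ht ↦ ?_
        rw [withDensity_apply _ measurableSet_Ioi]
        exact setLIntegral_Ioi_le_kernelOverlap hanti (mem_Ioi.1 ht).le
    _ ≤ _ := setLIntegral_le_lintegral _ _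

theorem rightMomentInfinite_comp_neg (α : ℝ) (m : ℝ → ℝ) (a : ℝ) :
    RightMomentInfinite α (fun x ↦ m (-x)) a ↔ LeftMomentInfinite α m a := by
  have integrand_comp_neg (x : ℝ) :
      (Ioi a).indicator (fun t ↦ ENNReal.ofReal (t * m (-t) ^ α)) (-x)
        = (Iio (-a)).indicator (fun t ↦ ENNReal.ofReal (-(t * m t ^ α))) x := by
    simp [indicator_apply, lt_neg]
  rw [RightMomentInfinite, LeftMomentInfinite, ← lintegral_indicator measurableSet_Ioi,
    ← lintegral_indicator measurableSet_Iio, ← lintegral_neg_eq_self]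
  simp only [integrand_comp_neg]

end Overlap

theorem mainTheorem6_general {Ω : Type*} [MeasurableSpace Ω] {P : Measure Ω}
    [IsProbabilityMeasure P] {α : ℝ} (hα0 : 0 < α) (hα2 : α < 2) {m : ℝ → ℝ}
    (hm : MemLp m (ENNReal.ofReal α)) {X : ℝ → Ω → ℝ} (hX : IsSaSMovingAverage α P m X) (a : ℝ) :
    (AntitoneOn (fun x ↦ |m x|) (Ioi a) → RightMomentInfinite α (fun x ↦ |m x|) a →
      IsLongRangeDependent P X) ∧
    (MonotoneOn (fun x ↦ |m x|) (Iio (-a)) → LeftMomentInfinite α (fun x ↦ |m x|) a →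
      IsLongRangeDependent P X) ∧
    ((∀ x, |m (-x)| = |m x|) →
      (RightMomentInfinite α (fun x ↦ |m x|) a ↔ LeftMomentInfinite α (fun x ↦ |m x|) a)) := by
  refine ⟨fun hanti h ↦ ?_, fun hmono h ↦ ?_, fun hsymm ↦ ?_⟩
  · exact hX.isLongRangeDependent hα0 hα2 hm (lintegral_kernelOverlap_eq_top hα0 hm hanti h)
  · have reflected_memLp : MemLp (fun x ↦ m (-x)) (ENNReal.ofReal α) := by
      simpa using memLp_comp_const_sub hm 0
    have reflected_antitone : AntitoneOn (fun x ↦ |m (-x)|) (Ioi a) := fun x hx y hy hxy ↦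
      hmono (neg_lt_neg (mem_Ioi.1 hy)) (neg_lt_neg (mem_Ioi.1 hx)) (neg_le_neg hxy)
    refine hX.isLongRangeDependent hα0 hα2 hm ?_
    simpa only [kernelOverlap_comp_neg] using lintegral_kernelOverlap_eq_top hα0 reflected_memLp
      reflected_antitone ((rightMomentInfinite_comp_neg α _ a).2 h)
  · simp only [← rightMomentInfinite_comp_neg, hsymm]

theorem mainTheorem6 {Ω : Type*} [MeasurableSpace Ω] (P : Measure Ω) [IsProbabilityMeasure P]
    (α : ℝ) (hα0 : 0 < α) (hα2 : α < 2)
    (m : ℝ → ℝ) (hm : MemLp m (ENNReal.ofReal α) volume) (hm0 : ∀ x, 0 ≤ m x)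
    (X : ℝ → Ω → ℝ) (hX : IsSaSMovingAverage α P m X)
    (a : ℝ) (ha : 0 < a) :
    (AntitoneOn m (Ioi a) → RightMomentInfinite α m a → IsLongRangeDependent P X) ∧
    (MonotoneOn m (Iio (-a)) → LeftMomentInfinite α m a → IsLongRangeDependent P X) ∧
    ((∀ x, m (-x) = m x) → (RightMomentInfinite α m a ↔ LeftMomentInfinite α m a)) := by
  simpa only [abs_of_nonneg (hm0 _)] using mainTheorem6_general hα0 hα2 hm hX a
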